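/- All graphs are finite, simple and undirected. The rank and the spectral radius of a graph are the rank and the spectral radius of its adjacency matrix. For a graph $H$ with vertices $v_1,\dots,v_k$ and a vector $\mathbf m=(n_1,\dots,n_k)$ of positive integers, let $H\circ\mathbf m$ be the graph obtained from $H$ by replacing each vertex $v_i$ with an independent set $V_i$ of $n_i$ vertices and joining each vertex of $V_i$ to each vertex of $V_j$ if and only if $v_iv_j\in E(H)$. Let $M_n(H)$ be the set of all graphs isomorphic to $H\circ(n_1,\dots,n_k)$ for some positive integers $n_i$ with $\sum_{i=1}^k n_i=n$, and let $M_n(H_1,\dots,H_l)=\bigcup_{i=1}^l M_n(H_i)$. Let $G_1$ be the graph on $v_1,\dots,v_5$ with edges $v_1v_2, v_1v_3, v_1v_4, v_2v_4, v_3v_5$; let $G_7=C_5$ be the cycle on five vertices; and let $G_{10}$ be the graph on $v_1,\dots,v_6$ with edges $v_1v_2, v_1v_3, v_1v_4, v_2v_3, v_2v_5, v_3v_5, v_4v_6$. **Proposition.** Let $G$ be a graph that attains the minimum spectral radius among all connected graphs of order $n$ and rank $5$. Then $G\in M_n(G_1,G_7,G_{10})$. -/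

import Mathlib

open scoped Classical in
/-- The rank of a finite graph: the rank of its adjacency matrix. -/
noncomputable def SimpleGraph.adjRank {V : Type*} [Fintype V] (G : SimpleGraph V) : ℕ :=
  (G.adjMatrix ℝ).rank

open scoped Classical in
/-- The spectral radius of a finite graph: the spectral radius of its adjacency matrix. The
adjacency matrix is real symmetric, so all its eigenvalues are real. -/
noncomputable def SimpleGraph.adjSpectralRadius {V : Type*} [Fintype V] (G : SimpleGraph V) :
    ENNReal :=
  spectralRadius ℝ (G.adjMatrix ℝ)

/-- `H ∘ m`: each vertex `i` of `H` is replaced by an independent set of `m i` vertices, and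
`(i, a)`, `(j, b)` are adjacent if and only if `i`, `j` are adjacent in `H`. -/
def SimpleGraph.vertexMul {W : Type*} (H : SimpleGraph W) (m : W → ℕ) :
    SimpleGraph (Σ i : W, Fin (m i)) where
  Adj x y := H.Adj x.1 y.1
  symm := ⟨fun _ _ h => h.symm⟩
  loopless := ⟨fun x h => H.loopless.irrefl x.1 h⟩

/-- `M_n(H)`, as a set of graphs on the vertex type `V`: the graphs isomorphic to `H ∘ m` for a
vector `m` of positive integers with sum `n`. -/
def SimpleGraph.mulSet {W : Type*} [Fintype W] (V : Type*) (n : ℕ) (H : SimpleGraph W) :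
    Set (SimpleGraph V) :=
  {G | ∃ m : W → ℕ, (∀ i, 0 < m i) ∧ ∑ i, m i = n ∧ Nonempty (G ≃g H.vertexMul m)}

/-- `G` attains the minimum spectral radius among all connected graphs of rank `r` on the
vertex type of `G`, hence, up to isomorphism, among all connected graphs of rank `r` that have
the order of `G`. -/
def SimpleGraph.IsMinSpectralRadius {V : Type*} [Fintype V] (r : ℕ) (G : SimpleGraph V) : Prop :=
  G.Connected ∧ G.adjRank = r ∧
    ∀ H : SimpleGraph V, H.Connected → H.adjRank = r →
      G.adjSpectralRadius ≤ H.adjSpectralRadius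

/-- The reduced graph `G₁`: a triangle `v₁v₂v₄` with a path `v₁v₃v₅` attached at `v₁`
(vertex `vᵢ` is `i - 1`). -/
def reducedG1 : SimpleGraph (Fin 5) :=
  SimpleGraph.fromEdgeSet {s(0, 1), s(0, 2), s(0, 3), s(1, 3), s(2, 4)}

/-- The reduced graph `G₇`: the cycle `C₅`. -/
def reducedG7 : SimpleGraph (Fin 5) := SimpleGraph.cycleGraph 5

/-- The reduced graph `G₁₀`: the two triangles `v₁v₂v₃` and `v₂v₃v₅` sharing the edge `v₂v₃`,
with a path `v₁v₄v₆` attached at `v₁` (vertex `vᵢ` is `i - 1`). -/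
def reducedG10 : SimpleGraph (Fin 6) :=
  SimpleGraph.fromEdgeSet
    {s(0, 1), s(0, 2), s(0, 3), s(1, 2), s(1, 4), s(2, 4), s(3, 5)}

/-! By Perron–Frobenius, deleting edges from a connected graph strictly lowers its spectral radius
(`SimpleGraph.Connected.adjSpectralRadius_lt`), so a minimiser equals each of its connected spanning
subgraphs of rank 5. Blow-ups of the three reduced graphs are connected of rank 5, so it suffices to
find one as a spanning subgraph of every connected graph of rank 5
(`exists_comap_le_of_adjRank_eq_five`).

A symmetric matrix of rank 5 has a nonsingular principal submatrix B of order 5, and its (u, v)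
entry is x_uᵀ B⁻¹ x_v, where x_u records the adjacencies of u to the five chosen vertices
(`Matrix.apply_eq_of_det_submatrix_ne_zero`). So adjacency depends only on the codes of x_u and x_v,
of which there are 32. Choosing the five vertices to induce as few edges as possible restricts the
codes further.

Up to isomorphism, B belongs to one of nine graphs: a pentagon, a triangle plus a disjoint edge, or
one of seven graphs containing G₁. In each case a finite check (`Reflects`) yields a map from codes
to the vertices of G₇, G₁₀ or G₁ under which nonadjacent vertices never get adjacent images. The
second case needs one further vertex, supplied by connectedness. -/

/-! ### Spectral radius and proper subgraphs -/

section Spectral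

open Matrix

variable {V : Type*} [Fintype V]

/-- If the entries of `A` are nonnegative, then `|yᵀ A y| ≤ |y|ᵀ A |y|`. -/
theorem Matrix.abs_dotProduct_mulVec_le {A : Matrix V V ℝ} (hA : ∀ i j, 0 ≤ A i j) (y : V → ℝ) :
    |y ⬝ᵥ A *ᵥ y| ≤ (fun i => |y i|) ⬝ᵥ A *ᵥ (fun i => |y i|) := by
  simp only [dotProduct, mulVec]
  refine (Finset.abs_sum_le_sum_abs _ _).trans (Finset.sum_le_sum fun i _ => ?_)
  rw [abs_mul]
  refine mul_le_mul_of_nonneg_left ?_ (abs_nonneg _)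
  refine (Finset.abs_sum_le_sum_abs _ _).trans (Finset.sum_le_sum fun j _ => ?_)
  rw [abs_mul, abs_of_nonneg (hA i j)]

theorem Matrix.spectralRadius_ne_top [DecidableEq V] (A : Matrix V V ℝ) :
    spectralRadius ℝ A ≠ ⊤ := by
  have hfin : (spectrum ℝ A).Finite := Matrix.finite_real_spectrum
  obtain ⟨C, hC⟩ := (hfin.image fun k => ‖k‖₊).bddAbove
  have h : spectralRadius ℝ A ≤ C := iSup₂_le fun k hk => by
    exact_mod_cast hC (Set.mem_image_of_mem _ hk)
  exact (h.trans_lt ENNReal.coe_lt_top).ne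

theorem Matrix.abs_le_toReal_spectralRadius [DecidableEq V] {A : Matrix V V ℝ} {k : ℝ}
    (hk : k ∈ spectrum ℝ A) : |k| ≤ (spectralRadius ℝ A).toReal := by
  have h : (‖k‖₊ : ENNReal) ≤ spectralRadius ℝ A := le_iSup₂ (f := fun k _ => (‖k‖₊ : ENNReal)) k hk
  have := ENNReal.toReal_mono A.spectralRadius_ne_top h
  simpa using this

/-- Semidefiniteness gives the Rayleigh bound together with its equality case: a vector attaining
the bound lies in the kernel, so it is an eigenvector. -/
theorem Matrix.IsHermitian.posSemidef_spectralRadius_sub [DecidableEq V] {A : Matrix V V ℝ}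
    (hA : A.IsHermitian) :
    (algebraMap ℝ (Matrix V V ℝ) (spectralRadius ℝ A).toReal - A).PosSemidef := by
  refine posSemidef_iff_isHermitian_and_spectrum_nonneg.2 ⟨?_, ?_⟩
  · refine IsHermitian.sub ?_ hA
    rw [Matrix.algebraMap_eq_diagonal]
    exact isHermitian_diagonal _
  · rw [← spectrum.singleton_sub_eq]
    rintro _ ⟨r, rfl, k, hk, rfl⟩
    have := abs_le_toReal_spectralRadius hk
    simp only [Set.mem_ofPred_eq]
    linarith [le_abs_self k]

theorem Matrix.exists_mem_spectrum_abs_eq [DecidableEq V] [Nonempty V] {A : Matrix V V ℝ}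
    (hA : A.IsHermitian) : ∃ k ∈ spectrum ℝ A, (spectralRadius ℝ A).toReal = |k| := by
  have hfin : (spectrum ℝ A).Finite := Matrix.finite_real_spectrum
  have hne : (spectrum ℝ A).Nonempty := by
    rw [hA.spectrum_real_eq_range_eigenvalues]; exact Set.range_nonempty _
  obtain ⟨k, hk, hmax⟩ := hfin.exists_maximalFor (fun k : ℝ => |k|) _ hne
  have hmax' : ∀ l ∈ spectrum ℝ A, |l| ≤ |k| := fun l hl => by
    rcases le_total |l| |k| with h | h
    · exact h
    · exact hmax hl h
  refine ⟨k, hk, le_antisymm ?_ (abs_le_toReal_spectralRadius hk)⟩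
  have : spectralRadius ℝ A ≤ (‖k‖₊ : ENNReal) := iSup₂_le fun l hl => by
    have := hmax' l hl
    exact_mod_cast this
  simpa using ENNReal.toReal_mono ENNReal.coe_ne_top this

theorem Matrix.exists_eigenvector_of_mem_spectrum [DecidableEq V] {A : Matrix V V ℝ} {k : ℝ}
    (hk : k ∈ spectrum ℝ A) : ∃ y : V → ℝ, y ≠ 0 ∧ A *ᵥ y = k • y := by
  rw [spectrum.mem_iff, Matrix.isUnit_iff_isUnit_det, isUnit_iff_ne_zero, not_not] at hk
  obtain ⟨y, hy, h⟩ := Matrix.exists_mulVec_eq_zero_iff.2 hk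
  refine ⟨y, hy, ?_⟩
  rw [sub_mulVec, sub_eq_zero, Algebra.algebraMap_eq_smul_one, smul_mulVec, one_mulVec] at h
  exact h.symm

open scoped Classical in
/-- A nonnegative eigenvector of a connected graph has no zero entry. -/
theorem SimpleGraph.Connected.pos_of_adjMatrix_mulVec_eq {G : SimpleGraph V} (hG : G.Connected)
    {x : V → ℝ} (hx : ∀ i, 0 ≤ x i) (hx0 : x ≠ 0) {r : ℝ} (h : G.adjMatrix ℝ *ᵥ x = r • x) (v : V) :
    0 < x v := by
  -- Where `x` vanishes, the eigenvalue equation makes a sum of nonnegative neighbouring entries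
  -- zero, so zeros spread along edges.
  have step : ∀ u w, G.Adj u w → x u = 0 → x w = 0 := by
    intro u w huw hu
    have h1 := congrFun h u
    rw [SimpleGraph.adjMatrix_mulVec_apply] at h1
    simp only [Pi.smul_apply, hu, smul_zero] at h1
    exact (Finset.sum_eq_zero_iff_of_nonneg fun i _ => hx i).1 h1 w (by simpa using huw)
  refine lt_of_le_of_ne (hx v) fun h0 => hx0 (funext fun w => ?_)
  obtain ⟨p⟩ := hG.preconnected v w
  have : ∀ {a b : V} (_ : G.Walk a b), x a = 0 → x b = 0 := by
    intro a b p
    induction p with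
    | nil => exact id
    | cons hab _ ih => exact fun ha => ih (step _ _ hab ha)
  exact this p h0.symm

/-- Deleting edges from a connected graph strictly decreases the spectral radius. -/
theorem SimpleGraph.Connected.adjSpectralRadius_lt {G' G : SimpleGraph V} (hG : G.Connected)
    (h : G' < G) : G'.adjSpectralRadius < G.adjSpectralRadius := by
  classical
  have := hG.nonempty
  unfold SimpleGraph.adjSpectralRadius
  set A := G.adjMatrix ℝ with hAdef
  set A' := G'.adjMatrix ℝ with hAdef'
  have hA : A.IsHermitian := by
    rw [IsHermitian, conjTranspose_eq_transpose_of_trivial]; exact G.isSymm_adjMatrix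
  have hA' : A'.IsHermitian := by
    rw [IsHermitian, conjTranspose_eq_transpose_of_trivial]; exact G'.isSymm_adjMatrix
  have hA0' : ∀ i j, 0 ≤ A' i j := fun i j => by
    rw [hAdef', SimpleGraph.adjMatrix_apply]; split_ifs <;> simp
  have hle : ∀ i j, A' i j ≤ A i j := fun i j => by
    rw [hAdef', hAdef, SimpleGraph.adjMatrix_apply, SimpleGraph.adjMatrix_apply]
    by_cases hij : G'.Adj i j
    · simp [hij, h.le hij]
    · simp only [hij, if_false]; split_ifs <;> simp
  -- With ρ ≤ ρ' and x = |y|, the chain ρ' x·x ≤ xᵀA'x ≤ xᵀAx ≤ ρ x·x collapses to equalities. Then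
  -- x is an eigenvector of A, positive by connectedness, and a deleted edge makes the middle
  -- inequality strict.
  by_contra hcon
  rw [not_lt] at hcon
  have hcon' := ENNReal.toReal_mono A'.spectralRadius_ne_top hcon
  obtain ⟨k, hk, hkr⟩ := exists_mem_spectrum_abs_eq hA'
  obtain ⟨y, hy0, hy⟩ := exists_eigenvector_of_mem_spectrum hk
  set x : V → ℝ := fun i => |y i| with hx
  have hxx : x ⬝ᵥ x = y ⬝ᵥ y := by simp [dotProduct, hx]
  have hyy : 0 ≤ y ⬝ᵥ y := by simpa using dotProduct_star_self_nonneg y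
  have h1 : (spectralRadius ℝ A').toReal * (x ⬝ᵥ x) ≤ x ⬝ᵥ A' *ᵥ x := by
    have := abs_dotProduct_mulVec_le hA0' y
    rwa [hy, dotProduct_smul, smul_eq_mul, abs_mul, abs_of_nonneg hyy, ← hkr, ← hxx] at this
  have hterm : ∀ i j, x i * (A' i j * x j) ≤ x i * (A i j * x j) := fun i j =>
    mul_le_mul_of_nonneg_left (mul_le_mul_of_nonneg_right (hle i j) (abs_nonneg _)) (abs_nonneg _)
  have hsum : ∀ B : Matrix V V ℝ, x ⬝ᵥ B *ᵥ x = ∑ i, ∑ j, x i * (B i j * x j) := fun B => by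
    simp [dotProduct, mulVec, Finset.mul_sum]
  have h2 : x ⬝ᵥ A' *ᵥ x ≤ x ⬝ᵥ A *ᵥ x := by
    rw [hsum, hsum]
    exact Finset.sum_le_sum fun i _ => Finset.sum_le_sum fun j _ => hterm i j
  have hpsd := hA.posSemidef_spectralRadius_sub
  have hform : x ⬝ᵥ (algebraMap ℝ (Matrix V V ℝ) (spectralRadius ℝ A).toReal - A) *ᵥ x =
      (spectralRadius ℝ A).toReal * (x ⬝ᵥ x) - x ⬝ᵥ A *ᵥ x := by
    rw [sub_mulVec, dotProduct_sub, Algebra.algebraMap_eq_smul_one, smul_mulVec, one_mulVec,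
      dotProduct_smul, smul_eq_mul]
  have h3 : 0 ≤ (spectralRadius ℝ A).toReal * (x ⬝ᵥ x) - x ⬝ᵥ A *ᵥ x := by
    rw [← hform]; simpa using hpsd.dotProduct_mulVec_nonneg x
  have h4 := mul_le_mul_of_nonneg_right hcon' (hxx ▸ hyy)
  have heq : x ⬝ᵥ A *ᵥ x = x ⬝ᵥ A' *ᵥ x := by linarith
  have hzero : (spectralRadius ℝ A).toReal * (x ⬝ᵥ x) - x ⬝ᵥ A *ᵥ x = 0 := by linarith
  have hev := (hpsd.dotProduct_mulVec_zero_iff x).1 (by rw [star_trivial, hform, hzero])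
  rw [sub_mulVec, sub_eq_zero, Algebra.algebraMap_eq_smul_one, smul_mulVec, one_mulVec] at hev
  have hx0 : x ≠ 0 := fun h0 => hy0 (funext fun i => by simpa [hx] using congrFun h0 i)
  have hpos := hG.pos_of_adjMatrix_mulVec_eq (fun i => abs_nonneg (y i)) hx0 hev.symm
  obtain ⟨u, w, huw, huw'⟩ : ∃ u w, G.Adj u w ∧ ¬ G'.Adj u w := by
    by_contra! hno
    exact h.not_ge fun u w huw => hno u w huw
  have hlt : x ⬝ᵥ A' *ᵥ x < x ⬝ᵥ A *ᵥ x := by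
    rw [hsum, hsum]
    refine Finset.sum_lt_sum (fun i _ => Finset.sum_le_sum fun j _ => hterm i j)
      ⟨u, Finset.mem_univ _, Finset.sum_lt_sum (fun j _ => hterm u j) ⟨w, Finset.mem_univ _, ?_⟩⟩
    have : 0 < x u * x w := mul_pos (hpos u) (hpos w)
    simpa [hAdef, hAdef', huw, huw'] using this
  linarith

end Spectral

/-! ### Symmetric matrices and nonsingular principal submatrices -/

section Rank

open Matrix

variable {V : Type*} [Fintype V]

/-- A symmetric matrix of rank `r` has a nonsingular principal submatrix of order `r`. -/
theorem Matrix.IsSymm.exists_det_submatrix_ne_zero {A : Matrix V V ℝ} (hA : A.IsSymm) {r : ℕ}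
    (hr : A.rank = r) : ∃ e : Fin r → V, (A.submatrix e e).det ≠ 0 := by
  obtain ⟨κ, a, hinj, hspan, hli⟩ := exists_linearIndependent' ℝ A.row
  have : Finite κ := Finite.of_injective a hinj
  have : Fintype κ := Fintype.ofFinite κ
  have hcard : Fintype.card κ = r := by
    rw [← hr, rank_eq_finrank_span_row, ← hspan, finrank_span_eq_card hli]
  subst hcard
  let f := (Fintype.equivFin κ).symm
  refine ⟨a ∘ f, fun hdet => ?_⟩
  obtain ⟨z, hz0, hz⟩ := exists_mulVec_eq_zero_iff.2 hdet
  have hli' : LinearIndependent ℝ (A.row ∘ a ∘ f) := hli.comp f f.injective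
  -- `z` is annihilated by the chosen rows, hence by all rows, which they span. By symmetry this is
  -- a linear relation among the chosen rows.
  have hrow : ∀ i, ∑ j, A i (a (f j)) * z j = 0 := by
    have hmem : ∀ x ∈ Submodule.span ℝ (Set.range A.row), ∑ j, x (a (f j)) * z j = 0 := by
      intro x hx
      rw [← hspan] at hx
      induction hx using Submodule.span_induction with
      | mem x hx =>
        obtain ⟨k, rfl⟩ := hx
        have := congrFun hz (f.symm k)
        simpa [mulVec, dotProduct] using this
      | zero => simp
      | add x y _ _ hx hy => simp [add_mul, Finset.sum_add_distrib, hx, hy]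
      | smul c x _ hx => simp [mul_assoc, ← Finset.mul_sum, hx]
    exact fun i => hmem _ (Submodule.subset_span ⟨i, rfl⟩)
  refine hz0 (funext fun j => Fintype.linearIndependent_iff.1 hli' z (funext fun i => ?_) j)
  rw [Finset.sum_apply, Pi.zero_apply, ← hrow i]
  exact Finset.sum_congr rfl fun j _ => by
    rw [← hA.apply i (a (f j))]; exact mul_comm _ _

/-- A symmetric matrix is determined by the rows of a nonsingular principal submatrix of
maximal order. -/
theorem Matrix.apply_eq_of_det_submatrix_ne_zero {A : Matrix V V ℝ} (hA : A.IsSymm) {r : ℕ}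
    (hr : A.rank = r) {e : Fin r → V} (hdet : (A.submatrix e e).det ≠ 0)
    {N : Matrix (Fin r) (Fin r) ℝ} {d : ℝ} (hN : A.submatrix e e * N = d • 1) (u v : V) :
    d * A u v = (fun i => A u (e i)) ⬝ᵥ N *ᵥ (fun i => A v (e i)) := by
  have hli : LinearIndependent ℝ (A.row ∘ e) := by
    rw [Fintype.linearIndependent_iff]
    intro g hg
    have : g ᵥ* A.submatrix e e = 0 := funext fun j => by
      have := congrFun hg (e j)
      rw [Finset.sum_apply] at this
      exact this
    exact congrFun (eq_zero_of_vecMul_eq_zero hdet this)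
  have hspan : Submodule.span ℝ (Set.range (A.row ∘ e)) = Submodule.span ℝ (Set.range A.row) := by
    refine Submodule.eq_of_le_of_finrank_eq
      (Submodule.span_mono (Set.range_comp_subset_range _ _)) ?_
    rw [finrank_span_eq_card hli, ← rank_eq_finrank_span_row, hr, Fintype.card_fin]
  have hu : A.row u ∈ Submodule.span ℝ (Set.range (A.row ∘ e)) :=
    hspan ▸ Submodule.subset_span ⟨u, rfl⟩
  obtain ⟨p, hp⟩ := (Submodule.mem_span_range_iff_exists_fun ℝ).1 hu
  have hp' : ∀ w, A u w = ∑ i, p i * A (e i) w := fun w => by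
    have := congrFun hp w
    rw [Finset.sum_apply] at this
    exact this.symm
  -- Row u is the combination `p` of the chosen rows, so multiplying its restriction by `N` returns
  -- d·p.
  have hx : (fun i => A u (e i)) = p ᵥ* A.submatrix e e := funext fun j => by
    simp [vecMul, dotProduct, hp' (e j)]
  rw [hx, dotProduct_mulVec, vecMul_vecMul, hN, vecMul_smul, vecMul_one, smul_dotProduct,
    smul_eq_mul, hp' v]
  congr 1
  exact Finset.sum_congr rfl fun i _ => by rw [hA.apply]

end Rank

/-! ### Blow-ups as pullbacks along surjections -/

namespace SimpleGraph

variable {V W : Type*}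

/-- Each adjacency matrix is a submatrix of the other, through `g` and through a right inverse of
`g`. -/
theorem adjRank_comap_of_surjective [Fintype V] [Fintype W] (H : SimpleGraph W) {g : V → W}
    (hg : Function.Surjective g) : (H.comap g).adjRank = H.adjRank := by
  classical
  unfold adjRank
  refine le_antisymm ?_ ?_
  · refine le_of_eq_of_le (congrArg Matrix.rank ?_) (Matrix.rank_submatrix_le (H.adjMatrix ℝ) g g)
    ext i j
    simp [adjMatrix_apply]
  · refine le_of_eq_of_le (congrArg Matrix.rank ?_) (Matrix.rank_submatrix_le
      _ (Function.surjInv hg) (Function.surjInv hg))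
    ext i j
    simp [adjMatrix_apply, Function.surjInv_eq hg]

/-- Walks of positive length lift with any prescribed ends. Two vertices of one fibre are joined
through a neighbouring fibre, which exists because `W` is nontrivial. -/
theorem Connected.comap_of_surjective [Nontrivial W] {H : SimpleGraph W} (hH : H.Connected)
    {g : V → W} (hg : Function.Surjective g) : (H.comap g).Connected := by
  have lift : ∀ {a b : W} (p : H.Walk a b), ∀ u v, g u = a → g v = b → a ≠ b ∨ 0 < p.length →
      (H.comap g).Reachable u v := by
    intro a b p
    induction p with
    | nil => intro u v _ _ h; simp at h
    | @cons a c b hac p ih =>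
      rintro u v rfl rfl -
      by_cases hp : 0 < p.length
      · obtain ⟨w, rfl⟩ := hg c
        exact (Adj.reachable (show (H.comap g).Adj u w from hac)).trans (ih w v rfl rfl (.inr hp))
      · cases p with
        | nil => exact Adj.reachable (show (H.comap g).Adj u v from hac)
        | cons _ _ => simp at hp
  have : Nonempty V := (hg hH.nonempty.some).nonempty
  refine (connected_iff _).2 ⟨fun u v => ?_, this⟩
  by_cases huv : g u = g v
  · obtain ⟨c, hc⟩ := hH.preconnected.exists_adj_of_nontrivial (g u)
    exact lift (.cons hc (.cons hc.symm .nil)) u v rfl huv.symm (.inr (by simp))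
  · obtain ⟨p⟩ := hH.preconnected (g u) (g v)
    exact lift p u v rfl rfl (.inl huv)

theorem comap_mem_mulSet [Fintype V] [Fintype W] (H : SimpleGraph W) {g : V → W} (hg : Function.Surjective g) :
    H.comap g ∈ mulSet V (Fintype.card V) H := by
  classical
  let E : V ≃ Σ i, Fin (Fintype.card {v // g v = i}) :=
    (Equiv.sigmaFiberEquiv g).symm.trans (Equiv.sigmaCongrRight fun i => Fintype.equivFin _)
  refine ⟨fun i => Fintype.card {v // g v = i}, fun i => ?_, ?_, ⟨⟨E, ?_⟩⟩⟩
  · obtain ⟨v, hv⟩ := hg i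
    exact Fintype.card_pos_iff.2 ⟨v, hv⟩
  · rw [Fintype.card_congr E, Fintype.card_sigma]
    simp
  · intro u v
    rfl

end SimpleGraph

/-! ### Graphs on five labelled vertices as Boolean matrices -/

namespace FivePattern

/-- The weight of the closed walk `a b c d e a`. -/
def cycleWeight (f : Fin 5 → Fin 5 → Bool) (a b c d e : Fin 5) : ℕ :=
  (f a b).toNat * (f b c).toNat * (f c d).toNat * (f d e).toNat * (f e a).toNat

/-- The number of spanning five-cycles. -/
def numFiveCycles (f : Fin 5 → Fin 5 → Bool) : ℕ :=
  cycleWeight f 0 1 2 3 4 + cycleWeight f 0 1 2 4 3 + cycleWeight f 0 1 3 2 4 +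
  cycleWeight f 0 1 3 4 2 + cycleWeight f 0 1 4 2 3 + cycleWeight f 0 1 4 3 2 +
  cycleWeight f 0 2 1 3 4 + cycleWeight f 0 2 1 4 3 + cycleWeight f 0 2 3 1 4 +
  cycleWeight f 0 2 4 1 3 + cycleWeight f 0 3 1 2 4 + cycleWeight f 0 3 2 1 4

/-- The weight of the triangle `a b c` together with the edge `d e`. -/
def triangleEdgeWeight (f : Fin 5 → Fin 5 → Bool) (a b c d e : Fin 5) : ℕ :=
  (f a b).toNat * (f b c).toNat * (f c a).toNat * ((f d e).toNat * (f e d).toNat)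

/-- The number of spanning unions of a triangle and a disjoint edge. -/
def numTriangleEdges (f : Fin 5 → Fin 5 → Bool) : ℕ :=
  triangleEdgeWeight f 2 3 4 0 1 + triangleEdgeWeight f 1 3 4 0 2 +
  triangleEdgeWeight f 1 2 4 0 3 + triangleEdgeWeight f 1 2 3 0 4 +
  triangleEdgeWeight f 0 3 4 1 2 + triangleEdgeWeight f 0 2 4 1 3 +
  triangleEdgeWeight f 0 2 3 1 4 + triangleEdgeWeight f 0 1 4 2 3 +
  triangleEdgeWeight f 0 1 3 2 4 + triangleEdgeWeight f 0 1 2 3 4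

/-- The number of edges. -/
def numEdges (f : Fin 5 → Fin 5 → Bool) : ℕ :=
  (f 0 1).toNat + (f 0 2).toNat + (f 0 3).toNat + (f 0 4).toNat + (f 1 2).toNat +
  (f 1 3).toNat + (f 1 4).toNat + (f 2 3).toNat + (f 2 4).toNat + (f 3 4).toNat

/-- By `det_eq`, this says that the adjacency matrix is nonsingular. -/
def Nonsing (f : Fin 5 → Fin 5 → Bool) : Prop := numFiveCycles f ≠ numTriangleEdges f

instance (f : Fin 5 → Fin 5 → Bool) : Decidable (Nonsing f) := inferInstanceAs (Decidable (_ ≠ _))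

set_option maxHeartbeats 1000000 in
/-- Twice the number of five-cycles minus that of triangle-edge pairs is the determinant. -/
theorem det_eq (f : Fin 5 → Fin 5 → Bool) (hs : ∀ i j, f i j = f j i) (h0 : ∀ i, f i i = false) :
    (Matrix.of fun i j => ((f i j).toNat : ℝ)).det =
      2 * ((numFiveCycles f : ℝ) - numTriangleEdges f) := by
  obtain ⟨M, hM⟩ : ∃ M : Matrix (Fin 5) (Fin 5) ℝ, M = Matrix.of fun i j => ((f i j).toNat : ℝ) :=
    ⟨_, rfl⟩
  have hf : ∀ i j, ((f i j).toNat : ℝ) = M i j := fun i j => by rw [hM]; rfl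
  have hMs : ∀ i j, M i j = M j i := fun i j => by rw [← hf, ← hf, hs]
  have hM0 : ∀ i, M i i = 0 := fun i => by rw [← hf, h0]; simp
  rw [← hM]
  simp only [numFiveCycles, numTriangleEdges, cycleWeight, triangleEdgeWeight, Nat.cast_add,
    Nat.cast_mul, hf]
  clear hf hM hs h0
  simp only [Matrix.det_succ_row_zero, Fin.sum_univ_succ]
  simp [hM0, Fin.succAbove]
  rw [hMs 1 0, hMs 2 0, hMs 3 0, hMs 4 0, hMs 2 1, hMs 3 1, hMs 4 1, hMs 3 2, hMs 4 2, hMs 4 3]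
  ring

/-- The graph on five vertices with a given list of edges. -/
def ofEdges (l : List (Fin 5 × Fin 5)) (i j : Fin 5) : Bool :=
  l.any fun p => p.1 == i && p.2 == j || p.1 == j && p.2 == i

/-- The nonsingular graphs on five vertices that have `reducedG1` as a spanning subgraph, one from
each isomorphism class. -/
def overG1 : List (List (Fin 5 × Fin 5)) :=
  [[(0, 1), (0, 2), (0, 3), (1, 3), (2, 4)],
   [(0, 1), (0, 2), (0, 3), (1, 3), (2, 4), (1, 2)],
   [(0, 1), (0, 2), (0, 3), (1, 3), (2, 4), (0, 4)],
   [(0, 1), (0, 2), (0, 3), (1, 3), (2, 4), (1, 2), (2, 3)],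
   [(0, 1), (0, 2), (0, 3), (1, 3), (2, 4), (1, 2), (0, 4)],
   [(0, 1), (0, 2), (0, 3), (1, 3), (2, 4), (1, 2), (0, 4), (1, 4)],
   [(0, 1), (0, 2), (0, 3), (1, 3), (2, 4), (1, 2), (0, 4), (1, 4), (2, 3), (3, 4)]]

/-- The edges of a five-cycle. -/
def pentagon : List (Fin 5 × Fin 5) := [(0, 1), (1, 2), (2, 3), (3, 4), (0, 4)]

/-- The edges of a triangle and a disjoint edge. -/
def triangleEdge : List (Fin 5 × Fin 5) := [(0, 1), (0, 2), (1, 2), (3, 4)]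

/-- The graph on five vertices whose edges are the binary digits of `b`. -/
def ofBits (b : ℕ) (i j : Fin 5) : Bool :=
  if i < j then b.testBit (j * (j - 1) / 2 + i)
  else if j < i then b.testBit (i * (i - 1) / 2 + j) else false

/-- `g` is obtained from `f` by relabelling the vertices. -/
def Relabels (f g : Fin 5 → Fin 5 → Bool) : Prop :=
  ∃ s₀ s₁, f s₀ s₁ = g 0 1 ∧
  ∃ s₂, (f s₀ s₂ = g 0 2 ∧ f s₁ s₂ = g 1 2) ∧
  ∃ s₃, (f s₀ s₃ = g 0 3 ∧ f s₁ s₃ = g 1 3 ∧ f s₂ s₃ = g 2 3) ∧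
  ∃ s₄, f s₀ s₄ = g 0 4 ∧ f s₁ s₄ = g 1 4 ∧ f s₂ s₄ = g 2 4 ∧ f s₃ s₄ = g 3 4

instance (f g : Fin 5 → Fin 5 → Bool) : Decidable (Relabels f g) := by
  unfold Relabels; infer_instance
-- Exhaustive search over the 2¹⁰ labelled graphs. `Relabels` does not record injectivity, so
-- equality of edge numbers is checked separately; it is needed to transfer minimality.
theorem exists_relabels_ofBits : ∀ b < 1024, Nonsing (ofBits b) →
    ∃ l ∈ triangleEdge :: pentagon :: overG1, numEdges (ofEdges l) = numEdges (ofBits b) ∧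
      Relabels (ofBits b) (ofEdges l) := by
  decide +kernel

theorem Relabels.exists_comp {f g : Fin 5 → Fin 5 → Bool} (hfg : Relabels f g)
    (hf : ∀ i j, f i j = f j i) (hf0 : ∀ i, f i i = false) (hg : ∀ i j, g i j = g j i)
    (hg0 : ∀ i, g i i = false) : ∃ s : Fin 5 → Fin 5, ∀ i j, f (s i) (s j) = g i j := by
  obtain ⟨s₀, s₁, h₁, s₂, ⟨h₂, h₃⟩, s₃, ⟨h₄, h₅, h₆⟩, s₄, h₇, h₈, h₉, h₁₀⟩ := hfg
  have key : ∀ i j : Fin 5, i < j → f (![s₀, s₁, s₂, s₃, s₄] i) (![s₀, s₁, s₂, s₃, s₄] j) = g i j := by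
    intro i j hij
    fin_cases i <;> fin_cases j <;> first | assumption | exact absurd hij (by decide)
  refine ⟨![s₀, s₁, s₂, s₃, s₄], fun i j => ?_⟩
  rcases lt_trichotomy i j with hij | rfl | hij
  · exact key i j hij
  · rw [hf0, hg0]
  · rw [hf, hg, key j i hij]

theorem ofEdges_comm (l : List (Fin 5 × Fin 5)) (i j : Fin 5) : ofEdges l i j = ofEdges l j i := by
  unfold ofEdges
  congr 1
  funext p
  exact Bool.or_comm _ _

theorem exists_ofBits_eq (f : Fin 5 → Fin 5 → Bool) (hf : ∀ i j, f i j = f j i)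
    (hf0 : ∀ i, f i i = false) : ∃ b < 1024, ofBits b = f := by
  -- The pair i < j occupies position j(j-1)/2 + i, as in `ofBits`.
  let k : Fin 10 → Bool :=
    ![f 0 1, f 0 2, f 1 2, f 0 3, f 1 3, f 2 3, f 0 4, f 1 4, f 2 4, f 3 4]
  have hk : ∀ i (hi : i < 10), (Nat.ofBits k).testBit i = k ⟨i, hi⟩ := Nat.testBit_ofBits_lt k
  have key : ∀ i j : Fin 5, i < j → ofBits (Nat.ofBits k) i j = f i j := by
    intro i j hij
    rw [ofBits, if_pos hij]
    fin_cases i <;> fin_cases j <;>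
      first
      | exact absurd hij (by decide)
      | exact (hk _ (by simp)).trans rfl
  refine ⟨Nat.ofBits k, Nat.ofBits_lt_two_pow k, ?_⟩
  funext i j
  rcases lt_trichotomy i j with hij | rfl | hij
  · exact key i j hij
  · simp [ofBits, hf0]
  · rw [hf, ← key j i hij]
    simp [ofBits, hij, hij.not_gt]

/-- Every nonsingular graph on five vertices can be relabelled to one of nine graphs. -/
theorem exists_relabelling (f : Fin 5 → Fin 5 → Bool) (hf : ∀ i j, f i j = f j i)
    (hf0 : ∀ i, f i i = false) (hns : Nonsing f) :
    ∃ l ∈ triangleEdge :: pentagon :: overG1, numEdges (ofEdges l) = numEdges f ∧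
      ∃ s : Fin 5 → Fin 5, ∀ i j, f (s i) (s j) = ofEdges l i j := by
  obtain ⟨b, hb, rfl⟩ := exists_ofBits_eq f hf hf0
  obtain ⟨l, hl, hle, hr⟩ := exists_relabels_ofBits b hb hns
  have hl0 : ∀ l ∈ triangleEdge :: pentagon :: overG1, ∀ i, ofEdges l i i = false := by decide
  exact ⟨l, hl, hle, hr.exists_comp hf hf0 (ofEdges_comm l) (hl0 l hl)⟩

/-! ### Codes of neighbourhoods and the finite checks -/

/-- The bilinear form `cᵀ N c'` on subsets of `Fin 5`, given by their binary codes. -/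
def form (N : Matrix (Fin 5) (Fin 5) ℤ) (c c' : ℕ) : ℤ :=
  ∑ i : Fin 5, ∑ j : Fin 5, if c.testBit i && c'.testBit j then N i j else 0

/-- Replace the vertex `i` by a vertex whose neighbourhood has the code `c`. -/
def replace (f : Fin 5 → Fin 5 → Bool) (i : Fin 5) (c : ℕ) (a b : Fin 5) : Bool :=
  if a = i then (if b = i then false else c.testBit b) else if b = i then c.testBit a else f a b

/-- The conditions on the code of the neighbourhood, within five vertices that induce the graph
`f`, of a further vertex. -/
def Admissible (f : Fin 5 → Fin 5 → Bool) (N : Matrix (Fin 5) (Fin 5) ℤ) (d : ℤ) (c₀ c : ℕ) :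
    Prop :=
  c ≠ 0 ∧ form N c c = 0 ∧ (form N c c₀ = 0 ∨ form N c c₀ = d) ∧
    ∀ i, Nonsing (replace f i c) → numEdges f ≤ numEdges (replace f i c)

instance (f : Fin 5 → Fin 5 → Bool) (N : Matrix (Fin 5) (Fin 5) ℤ) (d : ℤ) (c₀ c : ℕ) :
    Decidable (Admissible f N d c₀ c) := by
  unfold Admissible; infer_instance

/-- The map `g` from codes to the vertices of `h` sends adjacent vertices of `h` back to
adjacent vertices. -/
def Reflects {k : ℕ} (f : Fin 5 → Fin 5 → Bool) (N : Matrix (Fin 5) (Fin 5) ℤ) (d : ℤ) (c₀ : ℕ)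
    (h : Fin k → Fin k → Bool) (g : ℕ → Fin k) : Prop :=
  (∀ c : Fin 32, Admissible f N d c₀ c → ∀ c' : Fin 32, h (g c) (g c') = true →
    form N c c' = 0 → ¬ Admissible f N d c₀ c') ∧
  ∀ w, g c₀ = w ∨ ∃ i, g (Nat.ofBits (f i)) = w

instance {k : ℕ} (f : Fin 5 → Fin 5 → Bool) (N : Matrix (Fin 5) (Fin 5) ℤ) (d : ℤ) (c₀ : ℕ)
    (h : Fin k → Fin k → Bool) (g : ℕ → Fin k) : Decidable (Reflects f N d c₀ h g) := by
  unfold Reflects; infer_instance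

/-- `N` is `d` times the inverse of the adjacency matrix of `f`. -/
def IsScaledInverse (f : Fin 5 → Fin 5 → Bool) (N : Matrix (Fin 5) (Fin 5) ℤ) (d : ℤ) : Prop :=
  d ≠ 0 ∧ ∀ i j, ∑ k, ((f i k).toNat : ℤ) * N k j = if i = j then d else 0

instance (f : Fin 5 → Fin 5 → Bool) (N : Matrix (Fin 5) (Fin 5) ℤ) (d : ℤ) :
    Decidable (IsScaledInverse f N d) := by
  unfold IsScaledInverse; infer_instance

/-- The edges of `reducedG1`. -/
def edgesG1 : List (Fin 5 × Fin 5) := [(0, 1), (0, 2), (0, 3), (1, 3), (2, 4)]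

/-- The class in a blow-up of `reducedG1` of a vertex with code `c`: the vertex of `l` with the
same neighbourhood, if there is one, and otherwise the first vertex of `reducedG1` whose
neighbourhood is contained in that with code `c`. -/
def classG1 (l : List (Fin 5 × Fin 5)) (c : ℕ) : Fin 5 :=
  let v : List (Fin 5) := [0, 1, 2, 3, 4]
  (v.find? fun i => v.all fun j => c.testBit j == ofEdges l i j).getD
    ((v.find? fun i => v.all fun j => !ofEdges edgesG1 i j || c.testBit j).getD 0)

/-- The inverses follow the order of `overG1`, with `d` clearing denominators. Rows of a nonsingular
graph are distinct, so `classG1` sends the code of vertex i of `l` to i and every class is hit. -/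
theorem exists_reflects_G1 : ∀ l ∈ overG1, ∃ N d, IsScaledInverse (ofEdges l) N d ∧
    Reflects (ofEdges l) N d (Nat.ofBits (ofEdges l 0)) (ofEdges edgesG1) (classG1 l) := by
  simp only [overG1, List.forall_mem_cons]
  refine ⟨⟨!![-1, 1, 0, 1, 1; 1, -1, 0, 1, -1; 0, 0, 0, 0, 2; 1, 1, 0, -1, -1; 1, -1, 2, -1, -1],
      2, by decide +kernel⟩,
    ⟨!![-1, 1, 0, 1, 0; 1, -1, 0, 1, 0; 0, 0, 0, 0, 2; 1, 1, 0, -1, -2; 0, 0, 2, -2, 0],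
      2, by decide +kernel⟩,
    ⟨!![-1, 1, 1, 1, 1; 1, -1, -1, 3, -1; 1, -1, -1, -1, 3; 1, 3, -1, -1, -1; 1, -1, 3, -1, -1],
      4, by decide +kernel⟩,
    ⟨!![-1, 1, 0, 1, -1; 1, -1, 0, 1, -1; 0, 0, 0, 0, 2; 1, 1, 0, -1, -1; -1, -1, 2, -1, 3],
      2, by decide +kernel⟩,
    ⟨!![-1, 1, 1, 0, 0; 1, -1, -1, 2, 0; 1, -1, -1, 0, 2; 0, 2, 0, 0, -2; 0, 0, 2, -2, 0],
      2, by decide +kernel⟩,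
    ⟨!![-1, 1, 0, 1, 0; 1, -1, 0, 1, 0; 0, 0, 0, -2, 2; 1, 1, -2, 3, -2; 0, 0, 2, -2, 0],
      2, by decide +kernel⟩,
    ⟨!![-3, 1, 1, 1, 1; 1, -3, 1, 1, 1; 1, 1, -3, 1, 1; 1, 1, 1, -3, 1; 1, 1, 1, 1, -3],
      4, by decide +kernel⟩, List.forall_mem_nil _⟩

/-- Twice the inverse of the adjacency matrix of `pentagon`. -/
def invPentagon : Matrix (Fin 5) (Fin 5) ℤ :=
  !![1, 1, -1, -1, 1; 1, 1, 1, -1, -1; -1, 1, 1, 1, -1; -1, -1, 1, 1, 1; 1, -1, -1, 1, 1]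

/-- The class of a vertex with code `c` in a blow-up of a five-cycle. -/
def classG7 (c : ℕ) : Fin 5 :=
  (([0, 1, 2, 3, 4] : List (Fin 5)).find? fun i => c == Nat.ofBits (ofEdges pentagon i)).getD 0

/-- The nonzero codes isotropic for `invPentagon` are the five nonadjacent pairs, which are the
neighbourhoods in the pentagon. Hence the default in `classG7` is never used for an admissible code.
-/
theorem reflects_G7 : IsScaledInverse (ofEdges pentagon) invPentagon 2 ∧
    Reflects (ofEdges pentagon) invPentagon 2 (Nat.ofBits (ofEdges pentagon 0))
      (ofEdges pentagon) classG7 := by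
  decide +kernel

/-- Twice the inverse of the adjacency matrix of `triangleEdge`. -/
def invTriangleEdge : Matrix (Fin 5) (Fin 5) ℤ :=
  !![-1, 1, 1, 0, 0; 1, -1, 1, 0, 0; 1, 1, -1, 0, 0; 0, 0, 0, 0, 2; 0, 0, 0, 2, 0]

/-- Adjacency in `reducedG10`. -/
def adjG10 (i j : Fin 6) : Bool :=
  ([(0, 1), (0, 2), (0, 3), (1, 2), (1, 4), (2, 4), (3, 5)] : List (Fin 6 × Fin 6)).any fun p =>
    p.1 == i && p.2 == j || p.1 == j && p.2 == i

/-- The class of a vertex with code `c` in a blow-up of `reducedG10`. -/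
def classG10 (c : ℕ) : Fin 6 :=
  if c = 11 then 0 else if c = 6 ∨ c = 14 then 1 else if c = 5 ∨ c = 13 then 2
  else if c = 16 then 3 else if c = 3 ∨ c = 19 then 4 else 5

theorem isScaledInverse_triangleEdge :
    IsScaledInverse (ofEdges triangleEdge) invTriangleEdge 2 := by
  decide +kernel

/-- A nonzero isotropic code has zero or two triangle vertices and at most one end of the edge.
Pairing with the reference code 11 gives 4 for 21 and 22, which excludes them; of the nine codes
left, only 8 reaches the last branch of `classG10`. -/
theorem reflects_G10 :
    Reflects (ofEdges triangleEdge) invTriangleEdge 2 11 adjG10 classG10 := by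
  decide +kernel

end FivePattern

/-! ### Blow-ups inside connected graphs of rank five -/

namespace SimpleGraph

open FivePattern

theorem reducedG1_adj (i j : Fin 5) : reducedG1.Adj i j ↔ ofEdges edgesG1 i j = true := by
  revert i j
  simp only [reducedG1, fromEdgeSet_adj, Set.mem_insert_iff, Set.mem_singleton_iff]
  decide

theorem reducedG7_adj (i j : Fin 5) : reducedG7.Adj i j ↔ ofEdges pentagon i j = true := by
  revert i j
  simp only [reducedG7, cycleGraph_adj]
  decide

theorem reducedG10_adj (i j : Fin 6) : reducedG10.Adj i j ↔ adjG10 i j = true := by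
  revert i j
  simp only [reducedG10, fromEdgeSet_adj, Set.mem_insert_iff, Set.mem_singleton_iff]
  decide

variable {V : Type*}

open scoped Classical in
/-- The graph induced on the vertices `e 0, …, e 4`. -/
noncomputable def pattern (G : SimpleGraph V) (e : Fin 5 → V) (i j : Fin 5) : Bool :=
  decide (G.Adj (e i) (e j))

open scoped Classical in
/-- The binary code of the set of those `i` for which `e i` is adjacent to `v`. -/
noncomputable def code (G : SimpleGraph V) (e : Fin 5 → V) (v : V) : ℕ :=
  Nat.ofBits fun i => decide (G.Adj v (e i))

theorem pattern_comm (G : SimpleGraph V) (e : Fin 5 → V) (i j : Fin 5) :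
    G.pattern e i j = G.pattern e j i := by
  simp [pattern, G.adj_comm]

theorem pattern_self (G : SimpleGraph V) (e : Fin 5 → V) (i : Fin 5) : G.pattern e i i = false := by
  simp [pattern]

theorem code_lt (G : SimpleGraph V) (e : Fin 5 → V) (v : V) : G.code e v < 32 :=
  Nat.ofBits_lt_two_pow _

theorem code_apply (G : SimpleGraph V) (e : Fin 5 → V) (i : Fin 5) :
    G.code e (e i) = Nat.ofBits (G.pattern e i) := rfl

open scoped Classical in
theorem testBit_code (G : SimpleGraph V) (e : Fin 5 → V) (v : V) (i : Fin 5) :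
    (G.code e v).testBit i = decide (G.Adj v (e i)) :=
  Nat.testBit_ofBits_lt _ _ i.2

theorem pattern_update (G : SimpleGraph V) (e : Fin 5 → V) (i : Fin 5) (v : V) :
    G.pattern (Function.update e i v) = replace (G.pattern e) i (G.code e v) := by
  funext a b
  unfold replace
  by_cases ha : a = i <;> by_cases hb : b = i <;>
    simp [ha, hb, pattern, testBit_code, G.adj_comm]

open scoped Classical in
theorem adjMatrix_submatrix_eq (G : SimpleGraph V) (e : Fin 5 → V) :
    (G.adjMatrix ℝ).submatrix e e = Matrix.of fun i j => ((G.pattern e i j).toNat : ℝ) := by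
  ext i j
  by_cases h : G.Adj (e i) (e j) <;> simp [pattern, h]

open scoped Classical in
theorem det_submatrix_ne_zero_iff (G : SimpleGraph V) (e : Fin 5 → V) :
    ((G.adjMatrix ℝ).submatrix e e).det ≠ 0 ↔ Nonsing (G.pattern e) := by
  rw [adjMatrix_submatrix_eq, det_eq _ (G.pattern_comm e) (G.pattern_self e), Nonsing, not_iff_not]
  simp [sub_eq_zero]

variable [Fintype V] {G : SimpleGraph V}

/-- A graph of rank five has a nonsingular induced subgraph on five vertices; choose one with the
fewest edges. -/
theorem exists_nonsing_minimal (hr : G.adjRank = 5) : ∃ e : Fin 5 → V, Nonsing (G.pattern e) ∧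
    ∀ e' : Fin 5 → V, Nonsing (G.pattern e') → numEdges (G.pattern e) ≤ numEdges (G.pattern e') := by
  classical
  obtain ⟨e, he⟩ := (G.isSymm_adjMatrix (α := ℝ)).exists_det_submatrix_ne_zero hr
  obtain ⟨e, he, hmin⟩ := (measure fun e => numEdges (G.pattern e)).wf.has_min
    {e | Nonsing (G.pattern e)} ⟨e, (G.det_submatrix_ne_zero_iff e).1 he⟩
  exact ⟨e, he, fun e' he' => not_lt.1 (hmin e' he')⟩

open scoped Classical in
theorem form_code (hr : G.adjRank = 5) {e : Fin 5 → V} (he : Nonsing (G.pattern e))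
    {N : Matrix (Fin 5) (Fin 5) ℤ} {d : ℤ} (hN : IsScaledInverse (G.pattern e) N d) (u v : V) :
    form N (G.code e u) (G.code e v) = if G.Adj u v then d else 0 := by
  have hN' : (G.adjMatrix ℝ).submatrix e e * N.map (Int.cast : ℤ → ℝ) = (d : ℝ) • 1 := by
    ext i j
    have := congrArg (Int.cast : ℤ → ℝ) (hN.2 i j)
    rw [adjMatrix_submatrix_eq]
    simpa [Matrix.mul_apply, Matrix.one_apply] using this
  have h := Matrix.apply_eq_of_det_submatrix_ne_zero G.isSymm_adjMatrix hr
    ((G.det_submatrix_ne_zero_iff e).2 he) hN' u v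
  have hcast : ((form N (G.code e u) (G.code e v) : ℤ) : ℝ) = d * G.adjMatrix ℝ u v := by
    rw [h, form]
    simp only [dotProduct, Matrix.mulVec, Finset.mul_sum, testBit_code, adjMatrix_apply]
    push_cast
    refine Finset.sum_congr rfl fun i _ => Finset.sum_congr rfl fun j _ => ?_
    by_cases h₁ : G.Adj u (e i) <;> by_cases h₂ : G.Adj v (e j) <;> simp [h₁, h₂]
  rw [adjMatrix_apply] at hcast
  split_ifs at hcast ⊢ with h'
  · exact_mod_cast hcast.trans (mul_one _)
  · exact_mod_cast hcast.trans (mul_zero _)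

/-- The zero code pairs to zero with every code, so such a vertex would be isolated. -/
theorem Connected.code_ne_zero (hG : G.Connected) (hr : G.adjRank = 5) {e : Fin 5 → V}
    (he : Nonsing (G.pattern e)) {N : Matrix (Fin 5) (Fin 5) ℤ} {d : ℤ}
    (hN : IsScaledInverse (G.pattern e) N d) (v : V) : G.code e v ≠ 0 := by
  intro h0
  have : Nontrivial V := by
    by_contra hV
    rw [not_nontrivial_iff_subsingleton] at hV
    refine he ?_
    have : G.pattern e = fun _ _ => false := by
      funext i j
      simp [pattern, Subsingleton.elim (e i) (e j)]
    rw [this]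
    decide
  obtain ⟨w, hw⟩ := hG.preconnected.exists_adj_of_nontrivial v
  have h := form_code hr he hN v w
  rw [if_pos hw, h0] at h
  exact hN.1 (h.symm.trans (by simp [form]))

/-- Every vertex has an admissible code: exchanging it for one of the five cannot give a nonsingular
graph with fewer edges. The finite check then applies to all pairs of vertices. -/
theorem exists_comap_le_of_reflects (hG : G.Connected) (hr : G.adjRank = 5) {e : Fin 5 → V}
    (he : Nonsing (G.pattern e))
    (hmin : ∀ e' : Fin 5 → V, Nonsing (G.pattern e') →
      numEdges (G.pattern e) ≤ numEdges (G.pattern e'))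
    {N : Matrix (Fin 5) (Fin 5) ℤ} {d : ℤ} (hN : IsScaledInverse (G.pattern e) N d) {k : ℕ}
    {h : Fin k → Fin k → Bool} {g : ℕ → Fin k} (x : V)
    (hg : Reflects (G.pattern e) N d (G.code e x) h g) {H : SimpleGraph (Fin k)}
    (hH : ∀ i j, H.Adj i j → h i j = true) :
    ∃ g' : V → Fin k, Function.Surjective g' ∧ H.comap g' ≤ G := by
  have hadm : ∀ v, Admissible (G.pattern e) N d (G.code e x) (G.code e v) := fun v => by
    refine ⟨hG.code_ne_zero hr he hN v, ?_, ?_, fun i hi => ?_⟩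
    · simp [form_code hr he hN]
    · rw [form_code hr he hN]
      split_ifs <;> simp
    · rw [← pattern_update] at hi ⊢
      exact hmin _ hi
  refine ⟨fun v => g (G.code e v), fun w => ?_, fun u v huv => ?_⟩
  · rcases hg.2 w with hw | ⟨i, hi⟩
    · exact ⟨x, hw⟩
    · exact ⟨e i, hi⟩
  · by_contra hno
    refine hg.1 ⟨_, G.code_lt e u⟩ (hadm u) ⟨_, G.code_lt e v⟩ (hH _ _ huv) ?_ (hadm v)
    rw [form_code hr he hN, if_neg hno]

/-- A connected graph of rank five that contains an induced union of a triangle and a disjoint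
edge has a spanning blow-up of `reducedG10`. -/
theorem exists_comap_le_of_triangleEdge (hG : G.Connected) (hr : G.adjRank = 5) {e : Fin 5 → V}
    (he : G.pattern e = ofEdges triangleEdge)
    (hmin : ∀ e' : Fin 5 → V, Nonsing (G.pattern e') →
      numEdges (G.pattern e) ≤ numEdges (G.pattern e')) {H : SimpleGraph (Fin 6)}
    (hH : ∀ i j, H.Adj i j → adjG10 i j = true) :
    ∃ g : V → Fin 6, Function.Surjective g ∧ H.comap g ≤ G := by
  have hns : Nonsing (ofEdges triangleEdge) := by decide
  have hN := isScaledInverse_triangleEdge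
  rw [← he] at hns hN
  have hform := form_code hr hns hN
  obtain ⟨x, hx⟩ : ∃ x, ∀ i, G.code e x ≠ Nat.ofBits (ofEdges triangleEdge i) := by
    by_contra! hno
    -- Codes 3, 5, 6 are those of the triangle's vertices. If no new code occurred, these classes
    -- would be closed under adjacency and cut off from the edge.
    have step : ∀ u v, G.Adj u v → G.code e u ∈ [3, 5, 6] → G.code e v ∈ [3, 5, 6] := by
      intro u v huv hu
      have h := hform u v
      rw [if_pos huv] at h
      obtain ⟨i, hi⟩ := hno v
      have key : ∀ c ∈ [3, 5, 6], ∀ i, form invTriangleEdge c (Nat.ofBits (ofEdges triangleEdge i)) = 2 →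
          Nat.ofBits (ofEdges triangleEdge i) ∈ [3, 5, 6] := by decide +kernel
      rw [hi] at h ⊢
      exact key _ hu i h
    have walk : ∀ {u v : V} (_ : G.Walk u v), G.code e u ∈ [3, 5, 6] → G.code e v ∈ [3, 5, 6] := by
      intro u v p
      induction p with
      | nil => exact id
      | cons h _ ih => exact fun hu => ih (step _ _ h hu)
    obtain ⟨p⟩ := hG.preconnected (e 0) (e 3)
    have h3 := walk p (by rw [code_apply, he]; decide +kernel)
    rw [code_apply, he] at h3
    exact absurd h3 (by decide +kernel)
  -- A new code consists of two triangle vertices and one end of the edge; one of six automorphisms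
  -- moves it to {0, 1, 3}, that is, 11.
  have key : ∀ c : Fin 32, (c : ℕ) ≠ 0 → form invTriangleEdge c c = 0 →
      (∀ i, (c : ℕ) ≠ Nat.ofBits (ofEdges triangleEdge i)) →
      ∃ s ∈ ([![0, 1, 2, 3, 4], ![0, 2, 1, 3, 4], ![1, 2, 0, 3, 4], ![0, 1, 2, 4, 3],
        ![0, 2, 1, 4, 3], ![1, 2, 0, 4, 3]] : List (Fin 5 → Fin 5)),
      (∀ i j, ofEdges triangleEdge (s i) (s j) = ofEdges triangleEdge i j) ∧
        (Nat.ofBits fun i => (c : ℕ).testBit (s i)) = 11 := by decide +kernel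
  obtain ⟨s, -, hs, hcs⟩ := key ⟨_, G.code_lt e x⟩ (hG.code_ne_zero hr hns hN x)
    (by simp [hform]) hx
  have he' : G.pattern (e ∘ s) = ofEdges triangleEdge := by
    funext i j
    rw [← hs, ← he]
    rfl
  have hcode : G.code (e ∘ s) x = 11 := by
    rw [← hcs]
    simp [code]
  have hrefl := reflects_G10
  rw [← he', ← hcode] at hrefl
  have hpat : G.pattern (e ∘ s) = G.pattern e := he'.trans he.symm
  rw [← hpat] at hns hN hmin
  exact exists_comap_le_of_reflects hG hr hns hmin hN x hrefl hH

/-- A connected graph of rank five has a spanning subgraph that is a blow-up of one of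
`reducedG1`, `reducedG7` and `reducedG10`. -/
theorem exists_comap_le_of_adjRank_eq_five (hG : G.Connected) (hr : G.adjRank = 5) :
    (∃ g : V → Fin 5, Function.Surjective g ∧ reducedG1.comap g ≤ G) ∨
    (∃ g : V → Fin 5, Function.Surjective g ∧ reducedG7.comap g ≤ G) ∨
    ∃ g : V → Fin 6, Function.Surjective g ∧ reducedG10.comap g ≤ G := by
  obtain ⟨e, he, hmin⟩ := exists_nonsing_minimal hr
  obtain ⟨l, hl, hle, s, hs⟩ := exists_relabelling _ (G.pattern_comm e) (G.pattern_self e) he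
  have hpat : G.pattern (e ∘ s) = ofEdges l := funext fun i => funext fun j => hs i j
  rw [← hle, ← hpat] at hmin
  have hns : ∀ l ∈ triangleEdge :: pentagon :: overG1, Nonsing (ofEdges l) := by decide +kernel
  have hns := hns l hl
  rw [← hpat] at hns
  rcases List.mem_cons.1 hl with rfl | hl
  · refine .inr (.inr (exists_comap_le_of_triangleEdge hG hr hpat hmin fun i j hij => ?_))
    exact (reducedG10_adj i j).1 hij
  rcases List.mem_cons.1 hl with rfl | hl
  · obtain ⟨hN, hg⟩ := reflects_G7
    rw [← hpat] at hN hg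
    -- The reference vertex is one of the five, so the condition on pairing with it holds
    -- automatically.
    rw [← code_apply] at hg
    refine .inr (.inl (exists_comap_le_of_reflects hG hr hns hmin hN _ hg fun i j hij => ?_))
    rw [hpat]
    exact (reducedG7_adj i j).1 hij
  · obtain ⟨N, d, hN, hg⟩ := exists_reflects_G1 l hl
    rw [← hpat] at hN hg
    rw [← code_apply] at hg
    refine .inl (exists_comap_le_of_reflects hG hr hns hmin hN _ hg fun i j hij => ?_)
    exact (reducedG1_adj i j).1 hij

end SimpleGraph

/-! ### The three reduced graphs -/

namespace SimpleGraph

open FivePattern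

theorem connected_of_forall_exists_lt {n : ℕ} {H : SimpleGraph (Fin (n + 1))}
    (h : ∀ i, i ≠ 0 → ∃ j < i, H.Adj j i) : H.Connected := by
  have reach : ∀ i, H.Reachable 0 i := by
    intro i
    induction i using WellFoundedLT.induction with
    | ind i ih =>
      by_cases hi : i = 0
      · rw [hi]
      · obtain ⟨j, hj, hji⟩ := h i hi
        exact (ih j hj).trans hji.reachable
  exact (connected_iff _).2 ⟨fun i j => (reach i).symm.trans (reach j), ⟨0⟩⟩

theorem reducedG1_connected : reducedG1.Connected :=
  connected_of_forall_exists_lt (by simp only [reducedG1_adj]; decide)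

theorem reducedG7_connected : reducedG7.Connected :=
  connected_of_forall_exists_lt (by simp only [reducedG7_adj]; decide)

theorem reducedG10_connected : reducedG10.Connected :=
  connected_of_forall_exists_lt (by simp only [reducedG10_adj]; decide)

theorem five_le_adjRank {V : Type*} [Fintype V] {G : SimpleGraph V} {e : Fin 5 → V}
    (he : Nonsing (G.pattern e)) : 5 ≤ G.adjRank := by
  classical
  have hdet := (G.det_submatrix_ne_zero_iff e).2 he
  have h := Matrix.rank_of_isUnit _ ((Matrix.isUnit_iff_isUnit_det _).2 hdet.isUnit)
  rw [Fintype.card_fin] at h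
  exact h.symm.trans_le (Matrix.rank_submatrix_le _ e e)

theorem adjRank_eq_five {H : SimpleGraph (Fin 5)} {f : Fin 5 → Fin 5 → Bool}
    (hH : ∀ i j, H.Adj i j ↔ f i j = true) (hf : Nonsing f) : H.adjRank = 5 := by
  refine le_antisymm ((Matrix.rank_le_card_width _).trans_eq (Fintype.card_fin 5))
    (five_le_adjRank (e := id) ?_)
  have : H.pattern id = f := by
    funext i j
    simp [pattern, hH]
  rwa [this]

theorem reducedG1_adjRank : reducedG1.adjRank = 5 := adjRank_eq_five reducedG1_adj (by decide)

theorem reducedG7_adjRank : reducedG7.adjRank = 5 := adjRank_eq_five reducedG7_adj (by decide)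

theorem reducedG10_adjRank : reducedG10.adjRank = 5 := by
  classical
  -- Omitting v₅ leaves a copy of G₁.
  refine le_antisymm ?_ (five_le_adjRank (e := ![0, 1, 2, 3, 5]) ?_)
  -- The neighbourhood of v₁ is the disjoint union of those of v₅ and v₆.
  · have hker : (![1, 0, 0, 0, -1, -1] : Fin 6 → ℝ) ∈
        LinearMap.ker (reducedG10.adjMatrix ℝ).mulVecLin := by
      rw [LinearMap.mem_ker, Matrix.mulVecLin_apply]
      funext i
      fin_cases i <;>
        simp [Matrix.mulVec, dotProduct, Fin.sum_univ_succ, reducedG10_adj, adjG10]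
    have hne : LinearMap.ker (reducedG10.adjMatrix ℝ).mulVecLin ≠ ⊥ := fun h => by
      rw [h, Submodule.mem_bot] at hker
      simpa using congrFun hker 0
    have h1 := Submodule.one_le_finrank_iff.2 hne
    have h2 := LinearMap.finrank_range_add_finrank_ker (reducedG10.adjMatrix ℝ).mulVecLin
    rw [Module.finrank_fintype_fun_eq_card, Fintype.card_fin] at h2
    have h3 : reducedG10.adjRank =
        Module.finrank ℝ (LinearMap.range (reducedG10.adjMatrix ℝ).mulVecLin) := rfl
    omega
  · have : reducedG10.pattern ![0, 1, 2, 3, 5] =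
        fun i j => adjG10 (![0, 1, 2, 3, 5] i) (![0, 1, 2, 3, 5] j) := by
      funext i j
      simp [pattern, reducedG10_adj]
    rw [this]
    decide +kernel

/-- A graph of minimum spectral radius equals each connected spanning subgraph of the same rank. -/
theorem IsMinSpectralRadius.eq_of_le {V : Type*} [Fintype V] {r : ℕ} {G G' : SimpleGraph V}
    (hG : G.IsMinSpectralRadius r) (hc : G'.Connected) (hr : G'.adjRank = r) (hle : G' ≤ G) :
    G' = G := by
  by_contra hne
  exact (hG.1.adjSpectralRadius_lt (lt_of_le_of_ne hle hne)).not_ge (hG.2.2 G' hc hr)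

theorem IsMinSpectralRadius.mem_mulSet {V W : Type*} [Fintype V] [Fintype W] [Nontrivial W] {r : ℕ}
    {G : SimpleGraph V} (hG : G.IsMinSpectralRadius r) {H : SimpleGraph W} (hc : H.Connected)
    (hr : H.adjRank = r) {g : V → W} (hg : Function.Surjective g) (hle : H.comap g ≤ G) :
    G ∈ mulSet V (Fintype.card V) H := by
  rw [← hG.eq_of_le (hc.comap_of_surjective hg) ((H.adjRank_comap_of_surjective hg).trans hr) hle]
  exact H.comap_mem_mulSet hg

end SimpleGraph

theorem proposition3p3 {V : Type*} [Fintype V] (n : ℕ) (hn : Fintype.card V = n)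
    (G : SimpleGraph V) (hG : G.IsMinSpectralRadius 5) :
    G ∈ SimpleGraph.mulSet V n reducedG1 ∪ SimpleGraph.mulSet V n reducedG7 ∪
      SimpleGraph.mulSet V n reducedG10 := by
  subst hn
  rcases SimpleGraph.exists_comap_le_of_adjRank_eq_five hG.1 hG.2.1 with
    ⟨g, hg, hle⟩ | ⟨g, hg, hle⟩ | ⟨g, hg, hle⟩
  · exact .inl (.inl (hG.mem_mulSet SimpleGraph.reducedG1_connected
      SimpleGraph.reducedG1_adjRank hg hle))
  · exact .inl (.inr (hG.mem_mulSet SimpleGraph.reducedG7_connected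
      SimpleGraph.reducedG7_adjRank hg hle))
  · exact .inr (hG.mem_mulSet SimpleGraph.reducedG10_connected
      SimpleGraph.reducedG10_adjRank hg hle)
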